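/- Let $SG(n)$, $n\ge 0$, be the stage-$n$ two-dimensional Sierpinski gasket graph: $SG(0)$ is a triangle, and $SG(n+1)$ is obtained by juxtaposing three copies of $SG(n)$ (lower left, lower right, top), any two of which share exactly one outmost vertex. Let $o$, $a_n$, $b_n$ be the leftmost, rightmost and topmost vertices of $SG(n)$. Let $g(n)$ be the number of spanning subgraphs of $SG(n)$ that consist of exactly two trees, one containing $b_n$ and the other containing both $o$ and $a_n$ (an isolated vertex counts as a tree), and let $h(n)$ be the number of spanning subgraphs that consist of exactly three trees, such that $o$, $a_n$, $b_n$ lie in three different trees. For a vertex $x$ and $i\ge 0$ let $g_i(n,x)$ (respectively $h_i(n,x)$) be the number of those spanning subgraphs counted by $g(n)$ (respectively $h(n)$) in which $x$ has degree $i$, and put $G_i(n,x)=g_i(n,x)/g(n)$ and $H_i(n,x)=h_i(n,x)/h(n)$. Then for every integer $n\ge 0$ $$G_0(n,b_n)=\tfrac{33}{28}\left(\tfrac35\right)^n-\tfrac{5}{28}\left(\tfrac1{25}\right)^n,$$ $$H_0(n,o)=\tfrac{11}{14}\left(\tfrac35\right)^n+\tfrac{3}{14}\left(\tfrac1{25}\right)^n,$$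 $$G_1(n,b_n)=\tfrac{11}{14}-\tfrac27\left(\tfrac1{15}\right)^n-\tfrac67\left(\tfrac35\right)^n+\tfrac5{14}\left(\tfrac1{25}\right)^n,$$ $$G_2(n,b_n)=\tfrac{3}{14}+\tfrac27\left(\tfrac1{15}\right)^n-\tfrac9{28}\left(\tfrac35\right)^n-\tfrac5{28}\left(\tfrac1{25}\right)^n,$$ $$H_1(n,o)=\tfrac{11}{14}+\tfrac3{14}\left(\tfrac1{15}\right)^n-\tfrac47\left(\tfrac35\right)^n-\tfrac37\left(\tfrac1{25}\right)^n,$$ $$H_2(n,o)=\tfrac{3}{14}-\tfrac3{14}\left(\tfrac1{15}\right)^n-\tfrac3{14}\left(\tfrac35\right)^n+\tfrac3{14}\left(\tfrac1{25}\right)^n.$$ -/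

import Mathlib

/-!
The two-dimensional Sierpinski gasket `SG(n)`, drawn on the triangular lattice.  The pair
`(i, j)` stands for the lattice point `i • u + j • v`, where `u` points to the right and `v`
to the upper right (at 60 degrees); `SG(n)` has side length `2 ^ n` and its leftmost vertex
is `(0, 0)`.
-/

namespace SierpinskiGasket

/-- Translation of lattice points. -/
def shift (t p : ℕ × ℕ) : ℕ × ℕ := (p.1 + t.1, p.2 + t.2)

/-- Vertices of `SG(n)`: `SG(0)` is a triangle, and `SG(n+1)` consists of three copies of
`SG(n)`, placed at the lower left, the lower right and the top. -/
def verts : ℕ → Finset (ℕ × ℕ)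
  | 0 => {(0, 0), (1, 0), (0, 1)}
  | n + 1 => verts n ∪ (verts n).image (shift (2 ^ n, 0)) ∪ (verts n).image (shift (0, 2 ^ n))

/-- Edges of `SG(n)`, built by the same recursion. -/
def edges : ℕ → Finset (Sym2 (ℕ × ℕ))
  | 0 => {s((0, 0), (1, 0)), s((0, 0), (0, 1)), s((1, 0), (0, 1))}
  | n + 1 => edges n ∪ (edges n).image (Sym2.map (shift (2 ^ n, 0))) ∪
      (edges n).image (Sym2.map (shift (0, 2 ^ n)))

/-- The vertex type of `SG(n)`. -/
abbrev Vert (n : ℕ) : Type := {p : ℕ × ℕ // p ∈ verts n}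

/-- The graph `SG(n)`. -/
def SG (n : ℕ) : SimpleGraph (Vert n) :=
  SimpleGraph.comap Subtype.val
    (SimpleGraph.fromEdgeSet (edges n : Set (Sym2 (ℕ × ℕ))))

theorem origin_mem (n : ℕ) : ((0, 0) : ℕ × ℕ) ∈ verts n := by
  induction n with
  | zero => simp [verts]
  | succ n ih => simp [verts, ih]

theorem right_mem (n : ℕ) : ((2 ^ n, 0) : ℕ × ℕ) ∈ verts n := by
  induction n with
  | zero => simp [verts]
  | succ n ih =>
    refine Finset.mem_union_left _ (Finset.mem_union_right _ (Finset.mem_image.2 ⟨_, ih, ?_⟩))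
    simp only [shift, Prod.mk.injEq]
    exact ⟨by ring, trivial⟩

theorem top_mem (n : ℕ) : ((0, 2 ^ n) : ℕ × ℕ) ∈ verts n := by
  induction n with
  | zero => simp [verts]
  | succ n ih =>
    refine Finset.mem_union_right _ (Finset.mem_image.2 ⟨_, ih, ?_⟩)
    simp only [shift, Prod.mk.injEq]
    exact ⟨trivial, by ring⟩

/-- The leftmost vertex `o` of `SG(n)`. -/
def o (n : ℕ) : Vert n := ⟨(0, 0), origin_mem n⟩

/-- The rightmost vertex `a_n` of `SG(n)`. -/
def a (n : ℕ) : Vert n := ⟨(2 ^ n, 0), right_mem n⟩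

/-- The topmost vertex `b_n` of `SG(n)`. -/
def b (n : ℕ) : Vert n := ⟨(0, 2 ^ n), top_mem n⟩

/-- Spanning subgraphs of `SG(n)` that consist of `k` trees, i.e. acyclic ones with exactly
`k` connected components. -/
def spanningForests (n k : ℕ) : Set (SimpleGraph (Vert n)) :=
  {T | T ≤ SG n ∧ T.IsAcyclic ∧ Nat.card T.ConnectedComponent = k}

/-- Spanning subgraphs with two trees, one containing `b_n` and the other one containing
`o` and `a_n`. -/
def twoTrees (n : ℕ) : Set (SimpleGraph (Vert n)) :=
  {T | T ∈ spanningForests n 2 ∧ T.Reachable (o n) (a n) ∧ ¬ T.Reachable (o n) (b n)}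

/-- Spanning subgraphs with three trees such that `o`, `a_n` and `b_n` belong to three
different trees. -/
def threeTrees (n : ℕ) : Set (SimpleGraph (Vert n)) :=
  {T | T ∈ spanningForests n 3 ∧ ¬ T.Reachable (o n) (a n) ∧ ¬ T.Reachable (o n) (b n) ∧
    ¬ T.Reachable (a n) (b n)}

/-- `g(n)`. -/
noncomputable def g (n : ℕ) : ℕ := (twoTrees n).ncard

/-- `h(n)`. -/
noncomputable def h (n : ℕ) : ℕ := (threeTrees n).ncard

/-- `g_i(n, x)`: those configurations counted by `g(n)` in which `x` has degree `i`. -/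
noncomputable def gDeg (i n : ℕ) (x : Vert n) : ℕ :=
  {T | T ∈ twoTrees n ∧ (T.neighborSet x).ncard = i}.ncard

/-- `h_i(n, x)`: those configurations counted by `h(n)` in which `x` has degree `i`. -/
noncomputable def hDeg (i n : ℕ) (x : Vert n) : ℕ :=
  {T | T ∈ threeTrees n ∧ (T.neighborSet x).ncard = i}.ncard

/-- The probability `G_i(n, x) = g_i(n, x) / g(n)`. -/
noncomputable def G (i n : ℕ) (x : Vert n) : ℝ := (gDeg i n x : ℝ) / (g n : ℝ)

/-- The probability `H_i(n, x) = h_i(n, x) / h(n)`. -/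
noncomputable def H (i n : ℕ) (x : Vert n) : ℝ := (hDeg i n x : ℝ) / (h n : ℝ)

end SierpinskiGasket

/-! The edge set of `SG(n+1)` is the disjoint union of three copies of that of `SG(n)`, so a
spanning subgraph is a triple of spanning subgraphs of `SG(n)` (`glue`, `part`). Each induces one of
five partitions of the outmost vertices, its pattern. Whether every vertex of the glued graph
reaches an outmost vertex, and what its pattern is, depends on the three pieces only through the
same data (`spans_and_hasPattern_glue_iff`).

Acyclicity is encoded by an edge count: number of edges plus number of classes equals number of
vertices. The inequality `card_verts_le` always holds, and equality in the glued graph forces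
equality in each piece and an acyclic gluing (`glue_mem_configs_iff`). Hence the number of forests
with a given pattern is a sum over `glueTable` of products of three such numbers at stage `n`
(`weight_succ`).

An outmost vertex lies in just one copy, so fixing its degree changes a single factor of each
product. Since the totals have the form `F`, `F * t` (three times), `3 * F * t ^ 2`
(`exists_total_eq`), dividing by them leaves a linear recursion with constant coefficients. Its
relevant eigenvalues are 1, 3/5, 1/15 and 1/25, and the triangle gives the initial values. -/

namespace SierpinskiGasket

/-! ### Geometry of the three copies -/

/-- The three outmost vertices of `SG(n)`; they are also the translation vectors of the three
copies of `SG(n)` inside `SG(n+1)`. -/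
def corner (n : ℕ) : Fin 3 → ℕ × ℕ := ![(0, 0), (2 ^ n, 0), (0, 2 ^ n)]

theorem corner_mem (n : ℕ) (c : Fin 3) : corner n c ∈ verts n := by
  fin_cases c
  exacts [origin_mem n, right_mem n, top_mem n]

theorem corner_injective (n : ℕ) : Function.Injective (corner n) := by
  have hn : 0 < 2 ^ n := by positivity
  intro i j hij
  have hne : (0 : ℕ) ≠ 2 ^ n := hn.ne
  fin_cases i <;> fin_cases j <;> simp [corner] at hij ⊢
  all_goals exact hne hij

theorem shift_injective (t : ℕ × ℕ) : Function.Injective (shift t) := by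
  rintro ⟨a, b⟩ ⟨c, d⟩ h
  simpa [shift] using h

theorem shift_comm (s t : ℕ × ℕ) : shift s t = shift t s := by
  simp [shift, add_comm]

theorem corner_succ (n : ℕ) (c : Fin 3) :
    corner (n + 1) c = shift (corner n c) (corner n c) := by
  fin_cases c <;> simp [corner, shift, pow_succ, mul_two]

theorem shift_zero : shift (0, 0) = id := by
  funext p
  simp [shift]

theorem verts_succ (n : ℕ) :
    verts (n + 1) = Finset.univ.biUnion fun i => (verts n).image (shift (corner n i)) := by
  ext p
  simp only [verts, Finset.mem_union, Finset.mem_biUnion, Finset.mem_univ, true_and,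
    Fin.exists_fin_succ, or_assoc]
  have : corner n 0 = (0, 0) := rfl
  simp only [this, shift_zero, Finset.image_id]
  simp [corner]

theorem mem_verts_succ {n : ℕ} {p : ℕ × ℕ} :
    p ∈ verts (n + 1) ↔ ∃ i, ∃ v ∈ verts n, shift (corner n i) v = p := by
  simp [verts_succ]

theorem add_le_of_mem_verts {n : ℕ} {p : ℕ × ℕ} (hp : p ∈ verts n) : p.1 + p.2 ≤ 2 ^ n := by
  induction n generalizing p with
  | zero =>
    simp only [verts, Finset.mem_insert, Finset.mem_singleton] at hp
    rcases hp with rfl | rfl | rfl <;> simp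
  | succ n ih =>
    obtain ⟨i, v, hv, rfl⟩ := mem_verts_succ.1 hp
    have := ih hv
    fin_cases i <;> simp [shift, corner, pow_succ] <;> omega

/-- Two different copies meet in one outmost vertex. -/
theorem eq_corner_of_shift_eq {n : ℕ} {i j : Fin 3} (hij : i ≠ j) {p q : ℕ × ℕ}
    (hp : p ∈ verts n) (hq : q ∈ verts n) (h : shift (corner n i) p = shift (corner n j) q) :
    p = corner n j ∧ q = corner n i := by
  -- Each copy lies in a triangle `x + y ≤ 2 ^ n` translated by one of its own corners, and two such
  -- triangles touch in one point: corner `j` of copy `i`, which is corner `i` of copy `j`.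
  have h1 := add_le_of_mem_verts hp
  have h2 := add_le_of_mem_verts hq
  obtain ⟨p1, p2⟩ := p
  obtain ⟨q1, q2⟩ := q
  fin_cases i <;> fin_cases j <;> simp_all [shift, corner] <;> omega

/-- Inclusion-exclusion: two copies share one point, and the third copy meets their union in two
distinct points. -/
theorem card_verts_succ (n : ℕ) : (verts (n + 1)).card + 3 = 3 * (verts n).card := by
  have hinter : ∀ i j : Fin 3, i ≠ j →
      (verts n).image (shift (corner n i)) ∩ (verts n).image (shift (corner n j)) =
        {shift (corner n i) (corner n j)} := by
    intro i j hij
    ext p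
    simp only [Finset.mem_inter, Finset.mem_image, Finset.mem_singleton]
    constructor
    · rintro ⟨⟨u, hu, rfl⟩, v, hv, huv⟩
      rw [(eq_corner_of_shift_eq hij hu hv huv.symm).1]
    · rintro rfl
      exact ⟨⟨_, corner_mem n j, rfl⟩, _, corner_mem n i, shift_comm _ _⟩
  have hcard : ∀ i, ((verts n).image (shift (corner n i))).card = (verts n).card := fun i =>
    Finset.card_image_of_injective _ (shift_injective _)
  have hunion : verts (n + 1) = (verts n).image (shift (corner n 0)) ∪
      (verts n).image (shift (corner n 1)) ∪ (verts n).image (shift (corner n 2)) := by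
    rw [verts_succ]
    ext p
    simp [Fin.exists_fin_succ]
  have h1 := Finset.card_union_add_card_inter ((verts n).image (shift (corner n 0)))
    ((verts n).image (shift (corner n 1)))
  have h2 := Finset.card_union_add_card_inter ((verts n).image (shift (corner n 0)) ∪
    (verts n).image (shift (corner n 1))) ((verts n).image (shift (corner n 2)))
  have hne : shift (corner n 0) (corner n 2) ≠ shift (corner n 1) (corner n 2) := by
    rw [shift_comm, shift_comm (corner n 1)]
    exact fun h => absurd (corner_injective n (shift_injective _ h)) (by decide)
  rw [Finset.union_inter_distrib_right, hinter 0 2 (by decide), hinter 1 2 (by decide),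
    ← Finset.insert_eq, Finset.card_pair hne, ← hunion, hcard] at h2
  rw [hinter 0 1 (by decide), Finset.card_singleton, hcard, hcard] at h1
  omega

theorem mem_verts_of_mem_edges {n : ℕ} {p q : ℕ × ℕ} (h : s(p, q) ∈ edges n) :
    p ∈ verts n ∧ q ∈ verts n ∧ p ≠ q := by
  induction n generalizing p q with
  | zero =>
    simp only [edges, Finset.mem_insert, Finset.mem_singleton, Sym2.eq_iff] at h
    rcases h with (⟨rfl, rfl⟩ | ⟨rfl, rfl⟩) | (⟨rfl, rfl⟩ | ⟨rfl, rfl⟩) | ⟨rfl, rfl⟩ | ⟨rfl, rfl⟩ <;>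
      simp [verts]
  | succ n ih =>
    have key : ∀ i, s(p, q) ∈ (edges n).image (Sym2.map (shift (corner n i))) →
        p ∈ verts (n + 1) ∧ q ∈ verts (n + 1) ∧ p ≠ q := by
      intro i hi
      obtain ⟨e, he, hpq⟩ := Finset.mem_image.1 hi
      induction e with | _ u v
      obtain ⟨hu, hv, huv⟩ := ih he
      rw [Sym2.map_mk, Sym2.eq_iff] at hpq
      have hne := (shift_injective (corner n i)).ne huv
      rcases hpq with ⟨rfl, rfl⟩ | ⟨rfl, rfl⟩
      · exact ⟨mem_verts_succ.2 ⟨i, u, hu, rfl⟩, mem_verts_succ.2 ⟨i, v, hv, rfl⟩, hne⟩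
      · exact ⟨mem_verts_succ.2 ⟨i, v, hv, rfl⟩, mem_verts_succ.2 ⟨i, u, hu, rfl⟩, hne.symm⟩
    simp only [edges, Finset.mem_union] at h
    rcases h with (h | h) | h
    · refine key 0 ?_
      have : corner n 0 = (0, 0) := rfl
      rwa [this, shift_zero, Sym2.map_id, Finset.image_id]
    · exact key 1 h
    · exact key 2 h

/-! ### Gluing edge sets -/

/-- The union of edge sets drawn in the three copies. -/
def glue (n : ℕ) (E : Fin 3 → Finset (Sym2 (ℕ × ℕ))) : Finset (Sym2 (ℕ × ℕ)) :=
  Finset.univ.biUnion fun i => (E i).image (Sym2.map (shift (corner n i)))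

/-- The part of an edge set of `SG(n+1)` that lies in the `i`-th copy of `SG(n)`. -/
def part (n : ℕ) (F : Finset (Sym2 (ℕ × ℕ))) (i : Fin 3) : Finset (Sym2 (ℕ × ℕ)) :=
  (edges n).filter fun e => Sym2.map (shift (corner n i)) e ∈ F

theorem mem_glue {n : ℕ} {E : Fin 3 → Finset (Sym2 (ℕ × ℕ))} {e : Sym2 (ℕ × ℕ)} :
    e ∈ glue n E ↔ ∃ i, ∃ e' ∈ E i, Sym2.map (shift (corner n i)) e' = e := by
  simp [glue]

theorem edges_succ (n : ℕ) : edges (n + 1) = glue n fun _ => edges n := by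
  ext e
  have : corner n 0 = (0, 0) := rfl
  simp [edges, mem_glue, Fin.exists_fin_succ, this, shift_zero]
  simp [corner]

theorem glue_subset {n : ℕ} {E : Fin 3 → Finset (Sym2 (ℕ × ℕ))} (hE : ∀ i, E i ⊆ edges n) :
    glue n E ⊆ edges (n + 1) := by
  intro e he
  obtain ⟨i, e', he', rfl⟩ := mem_glue.1 he
  rw [edges_succ]
  exact mem_glue.2 ⟨i, e', hE i he', rfl⟩

theorem part_subset (n : ℕ) (F : Finset (Sym2 (ℕ × ℕ))) (i : Fin 3) : part n F i ⊆ edges n :=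
  Finset.filter_subset _ _

theorem glue_part {n : ℕ} {F : Finset (Sym2 (ℕ × ℕ))} (hF : F ⊆ edges (n + 1)) :
    glue n (part n F) = F := by
  ext e
  constructor
  · intro he
    obtain ⟨i, e', he', rfl⟩ := mem_glue.1 he
    exact (Finset.mem_filter.1 he').2
  · intro he
    have h := hF he
    rw [edges_succ] at h
    obtain ⟨i, e', he', rfl⟩ := mem_glue.1 h
    exact mem_glue.2 ⟨i, e', Finset.mem_filter.2 ⟨he', he⟩, rfl⟩

theorem eq_of_map_shift_eq {n : ℕ} {i j : Fin 3} {e e' : Sym2 (ℕ × ℕ)} (he : e ∈ edges n)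
    (he' : e' ∈ edges n)
    (h : Sym2.map (shift (corner n i)) e = Sym2.map (shift (corner n j)) e') : i = j ∧ e = e' := by
  have hij : i = j := by
    by_contra hij
    induction e with | _ p q
    induction e' with | _ p' q'
    obtain ⟨hp, hq, hpq⟩ := mem_verts_of_mem_edges he
    obtain ⟨hp', hq', -⟩ := mem_verts_of_mem_edges he'
    rw [Sym2.map_mk, Sym2.map_mk, Sym2.eq_iff] at h
    apply hpq
    rcases h with ⟨h1, h2⟩ | ⟨h1, h2⟩
    · rw [(eq_corner_of_shift_eq hij hp hp' h1).1, (eq_corner_of_shift_eq hij hq hq' h2).1]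
    · rw [(eq_corner_of_shift_eq hij hp hq' h1).1, (eq_corner_of_shift_eq hij hq hp' h2).1]
  subst hij
  exact ⟨rfl, Sym2.map.injective (shift_injective _) h⟩

theorem part_glue {n : ℕ} {E : Fin 3 → Finset (Sym2 (ℕ × ℕ))} (hE : ∀ i, E i ⊆ edges n) :
    part n (glue n E) = E := by
  funext i
  ext e
  simp only [part, Finset.mem_filter, mem_glue]
  constructor
  · rintro ⟨he, j, e', he', h⟩
    obtain ⟨rfl, rfl⟩ := eq_of_map_shift_eq (hE j he') he h
    exact he'
  · exact fun he => ⟨hE i he, i, e, he, rfl⟩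

theorem card_glue {n : ℕ} {E : Fin 3 → Finset (Sym2 (ℕ × ℕ))} (hE : ∀ i, E i ⊆ edges n) :
    (glue n E).card = ∑ i, (E i).card := by
  rw [glue, Finset.card_biUnion]
  · exact Finset.sum_congr rfl fun i _ =>
      Finset.card_image_of_injective _ (Sym2.map.injective (shift_injective _))
  · intro i _ j _ hij
    rw [Function.onFun, Finset.disjoint_left]
    intro e hi hj
    obtain ⟨e1, h1, rfl⟩ := Finset.mem_image.1 hi
    obtain ⟨e2, h2, h⟩ := Finset.mem_image.1 hj
    exact hij (eq_of_map_shift_eq (hE j h2) (hE i h1) h).1.symm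

/-- The number of edges of `E` at `x`. -/
def degreeAt (E : Finset (Sym2 (ℕ × ℕ))) (x : ℕ × ℕ) : ℕ := (E.filter fun e => x ∈ e).card

theorem degreeAt_glue {n : ℕ} {E : Fin 3 → Finset (Sym2 (ℕ × ℕ))} (hE : ∀ i, E i ⊆ edges n)
    (c : Fin 3) : degreeAt (glue n E) (corner (n + 1) c) = degreeAt (E c) (corner n c) := by
  have : (glue n E).filter (fun e => corner (n + 1) c ∈ e) =
      ((E c).filter fun e => corner n c ∈ e).image (Sym2.map (shift (corner n c))) := by
    ext e
    simp only [Finset.mem_filter, mem_glue, Finset.mem_image]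
    constructor
    · rintro ⟨⟨i, e', he', rfl⟩, hc⟩
      obtain ⟨v, hv, hvc⟩ := Sym2.mem_map.1 hc
      rw [corner_succ] at hvc
      obtain ⟨w, rfl⟩ := hv
      obtain ⟨hvm, -, -⟩ := mem_verts_of_mem_edges (hE i he')
      by_cases hic : i = c
      · subst hic
        obtain rfl := shift_injective _ hvc
        exact ⟨_, ⟨he', Sym2.mem_mk_left _ _⟩, rfl⟩
      · exact absurd (corner_injective n (eq_corner_of_shift_eq hic hvm (corner_mem n c) hvc).2)
          (Ne.symm hic)
    · rintro ⟨e', ⟨he', hc⟩, rfl⟩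
      exact ⟨⟨c, e', he', rfl⟩, by rw [corner_succ]; exact Sym2.mem_map.2 ⟨_, hc, rfl⟩⟩
  rw [degreeAt, this, Finset.card_image_of_injective _ (Sym2.map.injective (shift_injective _)),
    degreeAt]

/-! ### Connectivity -/

/-- `p` and `q` are joined by a path with edges in `E`. -/
def Conn (E : Finset (Sym2 (ℕ × ℕ))) (p q : ℕ × ℕ) : Prop :=
  Relation.ReflTransGen (fun x y => s(x, y) ∈ E) p q

theorem Conn.symm {E : Finset (Sym2 (ℕ × ℕ))} {p q : ℕ × ℕ} (h : Conn E p q) : Conn E q p := by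
  induction h with
  | refl => exact Relation.ReflTransGen.refl
  | tail _ h ih => exact Relation.ReflTransGen.head (by rwa [Sym2.eq_swap]) ih

theorem Conn.trans {E : Finset (Sym2 (ℕ × ℕ))} {p q r : ℕ × ℕ} (h : Conn E p q)
    (h' : Conn E q r) : Conn E p r :=
  Relation.ReflTransGen.trans h h'

theorem Conn.glue {n : ℕ} {E : Fin 3 → Finset (Sym2 (ℕ × ℕ))} {i : Fin 3} {p q : ℕ × ℕ}
    (h : Conn (E i) p q) :
    Conn (glue n E) (shift (corner n i) p) (shift (corner n i) q) := by
  induction h with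
  | refl => exact Relation.ReflTransGen.refl
  | tail _ h ih => exact Relation.ReflTransGen.tail ih (mem_glue.2 ⟨i, _, h, rfl⟩)

/-- The pair `(i, c)` stands for the corner `c` of the copy `i`.  One step identifies the common
corners of two copies, or moves inside one copy. -/
def Step (r : Fin 3 → Fin 3 → Fin 3 → Prop) (p q : Fin 3 × Fin 3) : Prop :=
  q = p.swap ∨ (p.1 = q.1 ∧ r p.1 p.2 q.2)

/-- The relation between corners of the copies generated by `Step`. -/
def Link (r : Fin 3 → Fin 3 → Fin 3 → Prop) : Fin 3 × Fin 3 → Fin 3 × Fin 3 → Prop :=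
  Relation.ReflTransGen (Step r)

theorem Link.symm {r : Fin 3 → Fin 3 → Fin 3 → Prop} (hr : ∀ i c d, r i c d → r i d c)
    {p q : Fin 3 × Fin 3} (h : Link r p q) : Link r q p := by
  induction h with
  | refl => exact Relation.ReflTransGen.refl
  | @tail x y _ hxy ih =>
    refine Relation.ReflTransGen.head ?_ ih
    rcases hxy with rfl | ⟨h1, h2⟩
    · exact Or.inl (Prod.swap_swap x).symm
    · exact Or.inr ⟨h1.symm, h1 ▸ hr _ _ _ h2⟩

theorem Link.step {r : Fin 3 → Fin 3 → Fin 3 → Prop} {p : Fin 3 × Fin 3} {i c d : Fin 3}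
    (h : Link r p (i, c)) (hr : r i c d) : Link r p (i, d) :=
  Relation.ReflTransGen.tail h (Or.inr ⟨rfl, hr⟩)

theorem Link.step_swap {r : Fin 3 → Fin 3 → Fin 3 → Prop} {p : Fin 3 × Fin 3} {i c d : Fin 3}
    (h : Link r p (i, c)) (hr : r i c d) : Link r p (d, i) :=
  Relation.ReflTransGen.tail (h.step hr) (Or.inl rfl)

/-- The connections between the corners inside each copy. -/
def cornerConn (n : ℕ) (E : Fin 3 → Finset (Sym2 (ℕ × ℕ))) (i c d : Fin 3) : Prop :=
  Conn (E i) (corner n c) (corner n d)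

/-- The corner `c` of the copy `i`. -/
def point (n : ℕ) (p : Fin 3 × Fin 3) : ℕ × ℕ := shift (corner n p.1) (corner n p.2)

theorem conn_glue_of_link {n : ℕ} {E : Fin 3 → Finset (Sym2 (ℕ × ℕ))} {p q : Fin 3 × Fin 3}
    (h : Link (cornerConn n E) p q) : Conn (glue n E) (point n p) (point n q) := by
  induction h with
  | refl => exact Relation.ReflTransGen.refl
  | @tail q r _ hqr ih =>
    refine ih.trans ?_
    obtain ⟨i, c⟩ := q
    obtain ⟨j, d⟩ := r
    rcases hqr with h | ⟨h1, h2⟩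
    · obtain ⟨rfl, rfl⟩ := Prod.mk.inj h
      simp only [point]
      rw [shift_comm]
      exact Relation.ReflTransGen.refl
    · obtain rfl : i = j := h1
      exact Conn.glue h2

/-- Invariant along a path: the current vertex is joined, inside its copy, to a corner linked to the
start. A path can change copy only at a common corner, which becomes the new reference corner. -/
theorem exists_link_of_conn_glue {n : ℕ} {E : Fin 3 → Finset (Sym2 (ℕ × ℕ))}
    (hE : ∀ i, E i ⊆ edges n) {p : Fin 3 × Fin 3} {w : ℕ × ℕ}
    (h : Conn (glue n E) (point n p) w) :
    ∃ i c, ∃ v ∈ verts n, w = shift (corner n i) v ∧ Conn (E i) (corner n c) v ∧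
      Link (cornerConn n E) p (i, c) := by
  induction h with
  | refl => exact ⟨p.1, p.2, _, corner_mem n _, rfl, Relation.ReflTransGen.refl,
      Relation.ReflTransGen.refl⟩
  | @tail w w' _ hww' ih =>
    obtain ⟨i, c, v, hv, rfl, hcv, hl⟩ := ih
    obtain ⟨j, e, he, hmap⟩ := mem_glue.1 hww'
    obtain ⟨u, u', he, hu, rfl⟩ : ∃ u u', s(u, u') ∈ E j ∧
        shift (corner n j) u = shift (corner n i) v ∧ shift (corner n j) u' = w' := by
      induction e with | _ u u'
      rw [Sym2.map_mk, Sym2.eq_iff] at hmap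
      rcases hmap with h | h
      · exact ⟨u, u', he, h.1, h.2⟩
      · exact ⟨u', u, by rwa [Sym2.eq_swap], h.2, h.1⟩
    obtain ⟨hum, hum', -⟩ := mem_verts_of_mem_edges (hE j he)
    by_cases hij : j = i
    · subst hij
      obtain rfl := shift_injective _ hu
      exact ⟨j, c, u', hum', rfl, Relation.ReflTransGen.tail hcv he, hl⟩
    · obtain ⟨rfl, rfl⟩ := eq_corner_of_shift_eq hij hum hv hu
      exact ⟨j, i, u', hum', rfl, Relation.ReflTransGen.single he,
        hl.step_swap hcv⟩

theorem conn_glue_iff_link {n : ℕ} {E : Fin 3 → Finset (Sym2 (ℕ × ℕ))}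
    (hE : ∀ i, E i ⊆ edges n) {p q : Fin 3 × Fin 3} :
    Conn (glue n E) (point n p) (point n q) ↔ Link (cornerConn n E) p q := by
  refine ⟨fun h => ?_, conn_glue_of_link⟩
  obtain ⟨i, c, v, hv, hq, hcv, hl⟩ := exists_link_of_conn_glue hE h
  obtain ⟨j, d⟩ := q
  by_cases hij : i = j
  · subst hij
    obtain rfl := shift_injective _ hq
    exact hl.step hcv
  · obtain ⟨rfl, hd⟩ := eq_corner_of_shift_eq hij hv (corner_mem n d) hq.symm
    obtain rfl := corner_injective n hd
    exact hl.step_swap hcv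

/-- Every vertex is joined to one of the outmost vertices. -/
def Spans (n : ℕ) (E : Finset (Sym2 (ℕ × ℕ))) : Prop :=
  ∀ v ∈ verts n, ∃ c, Conn E (corner n c) v

theorem spans_glue_iff {n : ℕ} {E : Fin 3 → Finset (Sym2 (ℕ × ℕ))} (hE : ∀ i, E i ⊆ edges n) :
    Spans (n + 1) (glue n E) ↔
      (∀ i, Spans n (E i)) ∧ ∀ p, ∃ c, Link (cornerConn n E) (c, c) p := by
  have hpt : ∀ c, corner (n + 1) c = point n (c, c) := fun c => corner_succ n c
  constructor
  · refine fun h => ⟨fun i v hv => ?_, fun p => ?_⟩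
    · obtain ⟨c, hc⟩ := h _ (mem_verts_succ.2 ⟨i, v, hv, rfl⟩)
      rw [hpt] at hc
      obtain ⟨j, d, u, hu, huv, hdu, -⟩ := exists_link_of_conn_glue hE hc
      by_cases hij : i = j
      · subst hij
        obtain rfl := shift_injective _ huv
        exact ⟨d, hdu⟩
      · obtain ⟨rfl, -⟩ := eq_corner_of_shift_eq hij hv hu huv
        exact ⟨j, Relation.ReflTransGen.refl⟩
    · obtain ⟨c, hc⟩ := h (point n p) (mem_verts_succ.2 ⟨p.1, _, corner_mem n p.2, rfl⟩)
      rw [hpt] at hc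
      exact ⟨c, (conn_glue_iff_link hE).1 hc⟩
  · rintro ⟨h1, h2⟩ w hw
    obtain ⟨i, v, hv, rfl⟩ := mem_verts_succ.1 hw
    obtain ⟨d, hd⟩ := h1 i v hv
    obtain ⟨c, hc⟩ := h2 (i, d)
    exact ⟨c, by rw [hpt]; exact (conn_glue_of_link hc).trans hd.glue⟩

/-! ### Patterns -/

/-- The five partitions of the three corners, as labellings: all together, one corner (`o`, `a`
or `b`) separated from the other two, all separated. -/
def lab : Fin 5 → Fin 3 → Fin 3 :=
  ![![0, 0, 0], ![0, 1, 1], ![0, 1, 0], ![0, 0, 1], ![0, 1, 2]]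

/-- The number of classes of a partition. -/
def rank (π : Fin 5) : ℕ := (Finset.univ.image (lab π)).card

/-- The relation on the corners of copies given by patterns inside the copies. -/
def patRel (π : Fin 3 → Fin 5) (i c d : Fin 3) : Prop := lab (π i) c = lab (π i) d

/-- A label of the class of the common corner of two different copies `i` and `c`. -/
def junctionLabel (r : Fin 3 → Fin 3 → Fin 3 → Bool) (i c : Fin 3) : ℕ :=
  match i.val + c.val with
  | 2 => bif r 0 1 2 || (r 1 0 2 && r 2 0 1) then 1 else 2
  | 3 => bif r 1 0 2 || (r 0 1 2 && r 2 0 1) then 1 else bif r 2 0 1 then 2 else 3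
  | k => k

/-- A label of the class of the corner `c` of the copy `i` under `Link (patRel π)`. -/
def label (π : Fin 3 → Fin 5) (i c : Fin 3) : ℕ :=
  let r : Fin 3 → Fin 3 → Fin 3 → Bool := fun i c d => decide (lab (π i) c = lab (π i) d)
  bif decide (i = c) then
    bif r i i (i + 1) then junctionLabel r i (i + 1)
    else bif r i i (i + 2) then junctionLabel r i (i + 2) else 4 + i
  else junctionLabel r i c

/-- A corner with a given label. -/
def labelPoint : ℕ → Fin 3 × Fin 3
  | 1 => (0, 1)
  | 2 => (0, 2)
  | 3 => (1, 2)
  | 4 => (0, 0)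
  | 5 => (1, 1)
  | _ => (2, 2)

theorem forall_fin_three_fun {P : (Fin 3 → Fin 5) → Prop} (h : ∀ x y z, P ![x, y, z])
    (π : Fin 3 → Fin 5) : P π := by
  have : π = ![π 0, π 1, π 2] := by
    funext i
    fin_cases i <;> rfl
  rw [this]
  exact h _ _ _

/-- Labels 1, 2, 3 name the junctions of copies {0,1}, {0,2}, {1,2}, merged to the smallest one
reachable; 4, 5, 6 name outer corners joined to no junction. Stability under both kinds of `Step`
makes the label an invariant of `Link`. -/
theorem label_stable : ∀ π : Fin 3 → Fin 5, ∀ i c : Fin 3, label π i c = label π c i ∧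
    ∀ d, lab (π i) c = lab (π i) d → label π i c = label π i d :=
  forall_fin_three_fun (by decide +kernel)

/-- The converse bound: three moves inside copies, some possibly trivial, with a swap between
consecutive ones and perhaps a final swap, reach the representative. This turns the transitive
closure into a finite check. -/
theorem exists_path_to_labelPoint : ∀ π : Fin 3 → Fin 5, ∀ i c : Fin 3, ∃ d,
    lab (π i) c = lab (π i) d ∧ ∃ e, lab (π d) i = lab (π d) e ∧ ∃ f, lab (π e) d = lab (π e) f ∧
      (labelPoint (label π i c) = (e, f) ∨ labelPoint (label π i c) = (f, e)) :=
  forall_fin_three_fun (by decide +kernel)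

theorem link_labelPoint (π : Fin 3 → Fin 5) (i c : Fin 3) :
    Link (patRel π) (i, c) (labelPoint (label π i c)) := by
  obtain ⟨d, hd, e, he, f, hf, h⟩ := exists_path_to_labelPoint π i c
  have h0 : Link (patRel π) (i, c) (i, c) := Relation.ReflTransGen.refl
  have h1 := (h0.step_swap hd).step_swap he
  rcases h with h | h <;> rw [h]
  · exact h1.step hf
  · exact h1.step_swap hf

theorem link_iff_label {π : Fin 3 → Fin 5} {p q : Fin 3 × Fin 3} :
    Link (patRel π) p q ↔ label π p.1 p.2 = label π q.1 q.2 := by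
  constructor
  · intro h
    induction h with
    | refl => rfl
    | @tail x y _ hxy ih =>
      rw [ih]
      rcases hxy with rfl | ⟨h1, h2⟩
      · exact (label_stable π x.1 x.2).1
      · rw [(label_stable π x.1 x.2).2 _ h2, h1]
  · intro h
    have h1 := link_labelPoint π p.1 p.2
    rw [h] at h1
    exact Relation.ReflTransGen.trans h1
      (Link.symm (fun i c d h => Eq.symm h) (link_labelPoint π q.1 q.2))

/-- The patterns `π` in the three copies produce the pattern `π'`, in such a way that every class
contains an outmost corner. -/
def Glues (π : Fin 3 → Fin 5) (π' : Fin 5) : Prop :=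
  (∀ c d, label π c c = label π d d ↔ lab π' c = lab π' d) ∧
    ∀ i c, ∃ d, label π d d = label π i c

instance (π : Fin 3 → Fin 5) (π' : Fin 5) : Decidable (Glues π π') :=
  inferInstanceAs (Decidable (_ ∧ _))

/-- The gluings that do not close a cycle. -/
def glueTable : Fin 5 → List (Fin 3 → Fin 5)
  | 0 => [
     ![0, 0, 1], ![0, 0, 2], ![0, 1, 0], ![0, 3, 0], ![2, 0, 0], ![3, 0, 0]]
  | 1 => [
     ![0, 1, 1], ![1, 0, 1], ![1, 0, 2], ![1, 1, 0], ![1, 3, 0], ![2, 0, 1], ![3, 1, 0],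
     ![4, 0, 0]]
  | 2 => [
     ![0, 1, 2], ![0, 2, 1], ![0, 2, 2], ![0, 4, 0], ![2, 0, 2], ![2, 2, 0], ![2, 3, 0],
     ![3, 2, 0]]
  | 3 => [
     ![0, 0, 4], ![0, 1, 3], ![0, 3, 1], ![0, 3, 3], ![2, 0, 3], ![3, 0, 2], ![3, 0, 3],
     ![3, 3, 0]]
  | 4 => [
     ![0, 1, 4], ![0, 2, 4], ![0, 4, 1], ![0, 4, 3], ![1, 0, 4], ![1, 1, 2], ![1, 1, 3],
     ![1, 2, 1], ![1, 2, 2], ![1, 3, 1], ![1, 3, 3], ![1, 4, 0], ![2, 0, 4], ![2, 2, 1],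
     ![2, 2, 3], ![2, 3, 1], ![2, 3, 3], ![3, 1, 2], ![3, 1, 3], ![3, 2, 2], ![3, 2, 3],
     ![3, 4, 0], ![4, 0, 2], ![4, 0, 3], ![4, 2, 0], ![4, 3, 0]]
-- Take the classes in the three copies as nodes and the three junctions as edges. Under `Glues`
-- this multigraph has `rank π'` components, and components are at least nodes minus edges, with
-- equality exactly for a forest.
theorem rank_le_of_glues : ∀ π : Fin 3 → Fin 5, ∀ π', Glues π π' →
    rank (π 0) + rank (π 1) + rank (π 2) ≤ rank π' + 3 :=
  forall_fin_three_fun (by decide +kernel)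

theorem mem_glueTable_iff : ∀ π : Fin 3 → Fin 5, ∀ π', π ∈ glueTable π' ↔
    Glues π π' ∧ rank (π 0) + rank (π 1) + rank (π 2) = rank π' + 3 :=
  forall_fin_three_fun (by decide +kernel)

theorem glueTable_nodup : ∀ π', (glueTable π').Nodup := by decide +kernel

theorem eq_of_lab_iff : ∀ π π' : Fin 5,
    (∀ c d, lab π c = lab π d ↔ lab π' c = lab π' d) → π = π' := by decide +kernel

/-- The connections between the outmost vertices are given by the pattern `π`. -/
def HasPattern (n : ℕ) (E : Finset (Sym2 (ℕ × ℕ))) (π : Fin 5) : Prop :=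
  ∀ c d, Conn E (corner n c) (corner n d) ↔ lab π c = lab π d

theorem HasPattern.unique {n : ℕ} {E : Finset (Sym2 (ℕ × ℕ))} {π π' : Fin 5}
    (h : HasPattern n E π) (h' : HasPattern n E π') : π = π' :=
  eq_of_lab_iff π π' fun c d => (h c d).symm.trans (h' c d)

/-- The hypotheses are transitivity: they exclude that exactly two of the three pairs are joined. -/
theorem exists_pattern : ∀ x y z : Bool, (x = true → y = true → z = true) →
    (x = true → z = true → y = true) → (y = true → z = true → x = true) →
    ∃ π, (x = true ↔ lab π 0 = lab π 1) ∧ (y = true ↔ lab π 0 = lab π 2) ∧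
      (z = true ↔ lab π 1 = lab π 2) := by decide +kernel

theorem exists_hasPattern (n : ℕ) (E : Finset (Sym2 (ℕ × ℕ))) : ∃ π, HasPattern n E π := by
  classical
  obtain ⟨π, h1, h2, h3⟩ := exists_pattern (decide (Conn E (corner n 0) (corner n 1)))
    (decide (Conn E (corner n 0) (corner n 2))) (decide (Conn E (corner n 1) (corner n 2)))
    (by simpa using fun h h' => h.symm.trans h') (by simpa using fun h h' => h.trans h')
    (by simpa using fun h h' => h.trans h'.symm)
  simp only [decide_eq_true_eq] at h1 h2 h3
  have hs : ∀ c d, Conn E (corner n c) (corner n d) ↔ Conn E (corner n d) (corner n c) :=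
    fun c d => ⟨Conn.symm, Conn.symm⟩
  refine ⟨π, fun c d => ?_⟩
  have hr : ∀ c, Conn E (corner n c) (corner n c) := fun c => Relation.ReflTransGen.refl
  fin_cases c <;> fin_cases d
  · simpa using hr 0
  · exact h1
  · exact h2
  · exact (hs 1 0).trans (h1.trans eq_comm)
  · simpa using hr 1
  · exact h3
  · exact (hs 2 0).trans (h2.trans eq_comm)
  · exact (hs 2 1).trans (h3.trans eq_comm)
  · simpa using hr 2

theorem spans_and_hasPattern_glue_iff {n : ℕ} {E : Fin 3 → Finset (Sym2 (ℕ × ℕ))}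
    (hE : ∀ i, E i ⊆ edges n) {π : Fin 3 → Fin 5} (hπ : ∀ i, HasPattern n (E i) (π i))
    (π' : Fin 5) :
    (Spans (n + 1) (glue n E) ∧ HasPattern (n + 1) (glue n E) π') ↔
      (∀ i, Spans n (E i)) ∧ Glues π π' := by
  have hrel : cornerConn n E = patRel π := by
    funext i c d
    exact propext (hπ i c d)
  have h1 : HasPattern (n + 1) (glue n E) π' ↔
      ∀ c d, label π c c = label π d d ↔ lab π' c = lab π' d := by
    refine forall_congr' fun c => forall_congr' fun d => ?_
    rw [corner_succ, corner_succ]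
    exact iff_congr ((conn_glue_iff_link (p := (c, c)) (q := (d, d)) hE).trans
      (by rw [hrel, link_iff_label])) Iff.rfl
  rw [spans_glue_iff hE, h1, hrel]
  simp only [link_iff_label, Prod.forall, Glues]
  tauto

/-! ### Counting -/

open Classical in
/-- The minimal edge sets with pattern `π` that span; these are the forests in which every tree
contains an outmost vertex. -/
noncomputable def configs (n : ℕ) (π : Fin 5) : Finset (Finset (Sym2 (ℕ × ℕ))) :=
  (edges n).powerset.filter fun E =>
    (Spans n E ∧ HasPattern n E π) ∧ E.card + rank π = (verts n).card

theorem mem_configs {n : ℕ} {π : Fin 5} {E : Finset (Sym2 (ℕ × ℕ))} :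
    E ∈ configs n π ↔
      E ⊆ edges n ∧ (Spans n E ∧ HasPattern n E π) ∧ E.card + rank π = (verts n).card := by
  simp [configs]

theorem corner_of_mem_verts_zero {v : ℕ × ℕ} (hv : v ∈ verts 0) : ∃ c, corner 0 c = v := by
  simp only [verts, Finset.mem_insert, Finset.mem_singleton] at hv
  rcases hv with rfl | rfl | rfl
  exacts [⟨0, rfl⟩, ⟨1, rfl⟩, ⟨2, rfl⟩]

theorem spans_zero (E : Finset (Sym2 (ℕ × ℕ))) : Spans 0 E := by
  intro v hv
  obtain ⟨c, rfl⟩ := corner_of_mem_verts_zero hv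
  exact ⟨c, Relation.ReflTransGen.refl⟩

/-- A decidable form of `HasPattern` for the triangle. -/
def TrianglePattern (E : Finset (Sym2 (ℕ × ℕ))) (π : Fin 5) : Prop :=
  (∀ c d, s(corner 0 c, corner 0 d) ∈ E → lab π c = lab π d) ∧
    ∀ c d, lab π c = lab π d → c = d ∨ s(corner 0 c, corner 0 d) ∈ E ∨
      ∃ x, s(corner 0 c, corner 0 x) ∈ E ∧ s(corner 0 x, corner 0 d) ∈ E

set_option synthInstance.maxSize 1000 in
set_option synthInstance.maxHeartbeats 200000 in
instance (E : Finset (Sym2 (ℕ × ℕ))) (π : Fin 5) : Decidable (TrianglePattern E π) :=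
  inferInstanceAs (Decidable (_ ∧ _))

/-- Labels are constant along edges, hence along paths; conversely, paths of length at most two
suffice in a triangle. -/
theorem TrianglePattern.hasPattern {E : Finset (Sym2 (ℕ × ℕ))} (hE : E ⊆ edges 0) {π : Fin 5}
    (h : TrianglePattern E π) : HasPattern 0 E π := by
  intro c d
  constructor
  · intro hcd
    have key : ∀ w, Conn E (corner 0 c) w → ∃ x, corner 0 x = w ∧ lab π c = lab π x := by
      intro w hw
      induction hw with
      | refl => exact ⟨c, rfl, rfl⟩
      | tail _ hyz ih =>
        obtain ⟨x, rfl, hx⟩ := ih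
        obtain ⟨z, rfl⟩ := corner_of_mem_verts_zero (mem_verts_of_mem_edges (hE hyz)).2.1
        exact ⟨z, rfl, hx.trans (h.1 _ _ hyz)⟩
    obtain ⟨x, hx, hl⟩ := key _ hcd
    rwa [← corner_injective 0 hx]
  · intro hl
    rcases h.2 c d hl with rfl | h | ⟨x, h1, h2⟩
    · exact Relation.ReflTransGen.refl
    · exact Relation.ReflTransGen.single h
    · exact (Relation.ReflTransGen.single h1).tail h2

theorem exists_trianglePattern : ∀ E ∈ (edges 0).powerset,
    ∃ π, TrianglePattern E π ∧ (verts 0).card ≤ E.card + rank π := by decide +kernel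

theorem hasPattern_zero_iff {E : Finset (Sym2 (ℕ × ℕ))} (hE : E ⊆ edges 0) {π : Fin 5} :
    HasPattern 0 E π ↔ TrianglePattern E π := by
  refine ⟨fun h => ?_, fun h => h.hasPattern hE⟩
  obtain ⟨π', h', -⟩ := exists_trianglePattern E (Finset.mem_powerset.2 hE)
  rwa [h.unique (h'.hasPattern hE)]

theorem configs_zero (π : Fin 5) : configs 0 π = (edges 0).powerset.filter fun E =>
    TrianglePattern E π ∧ E.card + rank π = (verts 0).card := by
  ext E
  rw [mem_configs, Finset.mem_filter, Finset.mem_powerset]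
  refine and_congr_right fun hE => ?_
  rw [hasPattern_zero_iff hE]
  simp [spans_zero]

/-- The bound "vertices ≤ edges + components", obtained from self-similarity: three copies of it are
added to `rank_le_of_glues` and `card_verts_succ`. -/
theorem card_verts_le {n : ℕ} {E : Finset (Sym2 (ℕ × ℕ))} (hE : E ⊆ edges n) {π : Fin 5}
    (hs : Spans n E) (hp : HasPattern n E π) : (verts n).card ≤ E.card + rank π := by
  induction n generalizing E π with
  | zero =>
    obtain ⟨π', h', hle⟩ := exists_trianglePattern E (Finset.mem_powerset.2 hE)
    rwa [hp.unique (h'.hasPattern hE)]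
  | succ n ih =>
    rw [← glue_part hE] at hs hp ⊢
    choose π' hπ' using fun i => exists_hasPattern n (part n E i)
    obtain ⟨h1, h2⟩ := (spans_and_hasPattern_glue_iff (part_subset n E) hπ' π).1 ⟨hs, hp⟩
    have h3 := rank_le_of_glues π' π h2
    have h4 := fun i => ih (part_subset n E i) (h1 i) (hπ' i)
    have h5 := card_verts_succ n
    rw [card_glue (part_subset n E), Fin.sum_univ_three]
    have := h4 0
    have := h4 1
    have := h4 2
    omega

theorem glue_mem_configs_iff {n : ℕ} {E : Fin 3 → Finset (Sym2 (ℕ × ℕ))}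
    (hE : ∀ i, E i ⊆ edges n) {π : Fin 3 → Fin 5} (hπ : ∀ i, HasPattern n (E i) (π i))
    {π' : Fin 5} :
    glue n E ∈ configs (n + 1) π' ↔ π ∈ glueTable π' ∧ ∀ i, E i ∈ configs n (π i) := by
  simp only [mem_configs, spans_and_hasPattern_glue_iff hE hπ, mem_glueTable_iff, card_glue hE,
    Fin.sum_univ_three]
  have h5 := card_verts_succ n
  constructor
  · rintro ⟨-, ⟨hs, hg⟩, hc⟩
    -- The total count is tight, so all four inequalities that add up to it must be equalities.
    have h3 := rank_le_of_glues π π' hg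
    have h0 := card_verts_le (hE 0) (hs 0) (hπ 0)
    have h1 := card_verts_le (hE 1) (hs 1) (hπ 1)
    have h2 := card_verts_le (hE 2) (hs 2) (hπ 2)
    refine ⟨⟨hg, by omega⟩, fun i => ⟨hE i, ⟨hs i, hπ i⟩, ?_⟩⟩
    fin_cases i <;> simp only [Fin.mk_zero, Fin.mk_one, Fin.reduceFinMk] <;> omega
  · rintro ⟨⟨hg, hr⟩, h⟩
    have h0 := (h 0).2.2
    have h1 := (h 1).2.2
    have h2 := (h 2).2.2
    exact ⟨glue_subset hE, ⟨fun i => (h i).2.1.1, hg⟩, by omega⟩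

/-- The weighted number of configurations with a given pattern. -/
noncomputable def weight (n : ℕ) (π : Fin 5) (w : Finset (Sym2 (ℕ × ℕ)) → ℝ) : ℝ :=
  ∑ E ∈ configs n π, w E

/-- Gluing is a bijection from triples of configurations whose patterns occur in the table; a weight
that factors over the copies then sums to a product. -/
theorem weight_succ (n : ℕ) (π' : Fin 5) (w : Finset (Sym2 (ℕ × ℕ)) → ℝ)
    (w' : Fin 3 → Finset (Sym2 (ℕ × ℕ)) → ℝ)
    (hw : ∀ E : Fin 3 → Finset (Sym2 (ℕ × ℕ)), (∀ i, E i ⊆ edges n) →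
      w (glue n E) = ∏ i, w' i (E i)) :
    weight (n + 1) π' w =
      ((glueTable π').map fun π => ∏ i, weight n (π i) (w' i)).sum := by
  rw [← List.sum_toFinset _ (glueTable_nodup π')]
  simp only [weight, Finset.prod_univ_sum]
  rw [Finset.sum_sigma']
  symm
  refine Finset.sum_bij (fun x _ => glue n x.2) ?_ ?_ ?_ ?_
  · rintro ⟨π, E⟩ h
    simp only [Finset.mem_sigma, List.mem_toFinset, Fintype.mem_piFinset] at h
    have h2 := fun i => mem_configs.1 (h.2 i)
    exact (glue_mem_configs_iff (fun i => (h2 i).1) fun i => (h2 i).2.1.2).2 h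
  · rintro ⟨π, E⟩ h ⟨ρ, F⟩ h' heq
    simp only [Finset.mem_sigma, List.mem_toFinset, Fintype.mem_piFinset] at h h' heq
    have h2 := fun i => mem_configs.1 (h.2 i)
    have h2' := fun i => mem_configs.1 (h'.2 i)
    obtain rfl : E = F := by
      rw [← part_glue fun i => (h2 i).1, heq, part_glue fun i => (h2' i).1]
    obtain rfl : π = ρ := funext fun i => (h2 i).2.1.2.unique (h2' i).2.1.2
    rfl
  · intro F hF
    have hsub := (mem_configs.1 hF).1
    choose π hπ using fun i => exists_hasPattern n (part n F i)
    refine ⟨⟨π, part n F⟩, ?_, glue_part hsub⟩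
    simp only [Finset.mem_sigma, List.mem_toFinset, Fintype.mem_piFinset]
    rw [← glue_mem_configs_iff (part_subset n F) hπ, glue_part hsub]
    exact hF
  · rintro ⟨π, E⟩ h
    simp only [Finset.mem_sigma, List.mem_toFinset, Fintype.mem_piFinset] at h
    exact (hw E fun i => (mem_configs.1 (h.2 i)).1).symm

/-! ### Recursions for the numbers of configurations -/

/-- The number of configurations with a given pattern. -/
noncomputable def total (n : ℕ) (π : Fin 5) : ℝ := weight n π fun _ => 1

open Classical in
/-- The number of configurations with a given pattern and degree `d` at the corner `c`. -/
noncomputable def degreeCount (n : ℕ) (c : Fin 3) (d : ℕ) (π : Fin 5) : ℝ :=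
  weight n π fun E => if degreeAt E (corner n c) = d then 1 else 0

theorem total_succ (n : ℕ) (π' : Fin 5) :
    total (n + 1) π' = ((glueTable π').map fun π => ∏ i, total n (π i)).sum :=
  weight_succ n π' _ (fun _ _ => 1) fun _ _ => by simp

theorem degreeCount_succ (n : ℕ) (c : Fin 3) (d : ℕ) (π' : Fin 5) :
    degreeCount (n + 1) c d π' = ((glueTable π').map fun π =>
      ∏ i, if i = c then degreeCount n c d (π i) else total n (π i)).sum := by
  classical
  rw [degreeCount, weight_succ n π' _ fun i E =>
    if i = c then (if degreeAt E (corner n c) = d then 1 else 0) else 1]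
  · congr 1
    refine List.map_congr_left fun π _ => Finset.prod_congr rfl fun i _ => ?_
    split_ifs <;> simp [degreeCount, total]
  · intro E hE
    rw [degreeAt_glue hE, Finset.prod_ite_eq']
    simp

theorem total_zero (π : Fin 5) : total 0 π = ![3, 1, 1, 1, 1] π := by
  have h : ∀ π, (configs 0 π).card = ![3, 1, 1, 1, 1] π := by
    simp only [configs_zero]
    decide +kernel
  rw [total, weight, Finset.sum_const, h]
  fin_cases π <;> simp

theorem degreeCount_zero (c : Fin 3) (d : ℕ) (π : Fin 5) :
    degreeCount 0 c d π = (((edges 0).powerset.filter fun E =>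
      (TrianglePattern E π ∧ E.card + rank π = (verts 0).card) ∧
        degreeAt E (corner 0 c) = d).card : ℝ) := by
  classical
  rw [degreeCount, weight, Finset.sum_boole, configs_zero, Finset.filter_filter]

theorem exists_total_eq (n : ℕ) : ∃ F t : ℝ, 0 < F ∧ 0 < t ∧
    total n = ![F, F * t, F * t, F * t, 3 * F * t ^ 2] := by
  induction n with
  | zero =>
    refine ⟨3, 1 / 3, by norm_num, by norm_num, funext fun π => ?_⟩
    rw [total_zero]
    fin_cases π <;> norm_num
  | succ n ih =>
    obtain ⟨F, t, hF, ht, h⟩ := ih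
    -- The table gives `6 F³t` for one class, `10 F³t²` for two (seven products plus one with a
    -- factor 3) and `50 F³t³` for three, which preserves the shape.
    refine ⟨6 * F ^ 3 * t, 5 / 3 * t, by positivity, by positivity, funext fun π => ?_⟩
    rw [total_succ]
    fin_cases π <;> simp [glueTable, Fin.prod_univ_three, h] <;> ring

theorem total_pos (n : ℕ) (π : Fin 5) : 0 < total n π := by
  obtain ⟨F, t, hF, ht, h⟩ := exists_total_eq n
  rw [h]
  fin_cases π <;> simp <;> positivity

/-! ### Linear recursion for the degree distributions and its solution -/

/-- The evolution of the degree distribution at the corner `o`. -/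
noncomputable def evolveLeft (x : Fin 5 → ℝ) : Fin 5 → ℝ :=
  ![2 / 3 * x 0 + 1 / 6 * x 2 + 1 / 6 * x 3,
    1 / 10 * x 0 + 2 / 5 * x 1 + 1 / 10 * x 2 + 1 / 10 * x 3 + 3 / 10 * x 4,
    3 / 5 * x 0 + 3 / 10 * x 2 + 1 / 10 * x 3,
    3 / 5 * x 0 + 1 / 10 * x 2 + 3 / 10 * x 3,
    6 / 25 * x 0 + 6 / 25 * x 1 + 7 / 50 * x 2 + 7 / 50 * x 3 + 6 / 25 * x 4]

/-- The evolution of the degree distribution at the corner `b`. -/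
noncomputable def evolveTop (x : Fin 5 → ℝ) : Fin 5 → ℝ :=
  ![2 / 3 * x 0 + 1 / 6 * x 1 + 1 / 6 * x 2,
    3 / 5 * x 0 + 3 / 10 * x 1 + 1 / 10 * x 2,
    3 / 5 * x 0 + 1 / 10 * x 1 + 3 / 10 * x 2,
    1 / 10 * x 0 + 1 / 10 * x 1 + 1 / 10 * x 2 + 2 / 5 * x 3 + 3 / 10 * x 4,
    6 / 25 * x 0 + 7 / 50 * x 1 + 7 / 50 * x 2 + 6 / 25 * x 3 + 6 / 25 * x 4]

/-- All products for a given `π'` carry the same powers of `F` and `t`, which cancel. Each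
coefficient is the share of gluings, weighted by `total`, with the given pattern in the copy
containing the corner. -/
theorem degreeCount_left {n d : ℕ} {x : Fin 5 → ℝ}
    (h : ∀ π, degreeCount n 0 d π = x π * total n π) (π : Fin 5) :
    degreeCount (n + 1) 0 d π = evolveLeft x π * total (n + 1) π := by
  obtain ⟨F, t, -, -, hT⟩ := exists_total_eq n
  rw [degreeCount_succ, total_succ]
  fin_cases π <;> simp [glueTable, Fin.prod_univ_three, h, hT, evolveLeft] <;> ring

theorem degreeCount_top {n d : ℕ} {x : Fin 5 → ℝ}
    (h : ∀ π, degreeCount n 2 d π = x π * total n π) (π : Fin 5) :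
    degreeCount (n + 1) 2 d π = evolveTop x π * total (n + 1) π := by
  obtain ⟨F, t, -, -, hT⟩ := exists_total_eq n
  rw [degreeCount_succ, total_succ]
  fin_cases π <;> simp [glueTable, Fin.prod_univ_three, h, hT, evolveTop] <;> ring

/-- The degree distribution at a corner: the classes of patterns are those with all corners
together, with the corner itself alone, with another corner alone, and with all separate. -/
noncomputable def degreeDist (d n : ℕ) : Fin 4 → ℝ :=
  match d with
  | 0 => ![0, 33 / 28 * (3 / 5) ^ n - 5 / 28 * (1 / 25) ^ n, 0,
      11 / 14 * (3 / 5) ^ n + 3 / 14 * (1 / 25) ^ n]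
  | 1 => ![11 / 14 - 5 / 42 * (1 / 15) ^ n,
      11 / 14 - 2 / 7 * (1 / 15) ^ n - 6 / 7 * (3 / 5) ^ n + 5 / 14 * (1 / 25) ^ n,
      11 / 14 + 3 / 14 * (1 / 15) ^ n,
      11 / 14 + 3 / 14 * (1 / 15) ^ n - 4 / 7 * (3 / 5) ^ n - 3 / 7 * (1 / 25) ^ n]
  | _ => ![3 / 14 + 5 / 42 * (1 / 15) ^ n,
      3 / 14 + 2 / 7 * (1 / 15) ^ n - 9 / 28 * (3 / 5) ^ n - 5 / 28 * (1 / 25) ^ n,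
      3 / 14 - 3 / 14 * (1 / 15) ^ n,
      3 / 14 - 3 / 14 * (1 / 15) ^ n - 3 / 14 * (3 / 5) ^ n + 3 / 14 * (1 / 25) ^ n]

theorem card_triangle_left : ∀ d : Fin 3, ∀ π : Fin 5, ((edges 0).powerset.filter fun E =>
      (TrianglePattern E π ∧ E.card + rank π = (verts 0).card) ∧
        degreeAt E (corner 0 0) = d).card =
    ![![0, 1, 0, 0, 1], ![2, 0, 1, 1, 0], ![1, 0, 0, 0, 0]] d π := by decide +kernel

theorem card_triangle_top : ∀ d : Fin 3, ∀ π : Fin 5, ((edges 0).powerset.filter fun E =>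
      (TrianglePattern E π ∧ E.card + rank π = (verts 0).card) ∧
        degreeAt E (corner 0 2) = d).card =
    ![![0, 0, 0, 1, 1], ![2, 1, 1, 0, 0], ![1, 0, 0, 0, 0]] d π := by decide +kernel

/-- Exchanging the other two corners merges patterns 2 and 3. The classes where the corner is joined
to another evolve by themselves, with eigenvalues 1 and 1/15; the remaining two classes contribute
3/5 and 1/25. -/
theorem degreeCount_left_eq (n : ℕ) (d : Fin 3) (π : Fin 5) :
    degreeCount n 0 d π = degreeDist d n (![0, 1, 2, 2, 3] π) * total n π := by
  induction n generalizing π with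
  | zero =>
    rw [degreeCount_zero, card_triangle_left, total_zero]
    fin_cases d <;> fin_cases π <;> norm_num [degreeDist] <;> rfl
  | succ n ih =>
    rw [degreeCount_left ih]
    congr 1
    fin_cases d <;> fin_cases π <;> simp [degreeDist, evolveLeft, pow_succ] <;> ring

theorem degreeCount_top_eq (n : ℕ) (d : Fin 3) (π : Fin 5) :
    degreeCount n 2 d π = degreeDist d n (![0, 2, 2, 1, 3] π) * total n π := by
  induction n generalizing π with
  | zero =>
    rw [degreeCount_zero, card_triangle_top, total_zero]
    fin_cases d <;> fin_cases π <;> norm_num [degreeDist] <;> rfl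
  | succ n ih =>
    rw [degreeCount_top ih]
    congr 1
    fin_cases d <;> fin_cases π <;> simp [degreeDist, evolveTop, pow_succ] <;> ring

/-! ### Forests with prescribed roots -/

section Forest

open SimpleGraph

variable {V : Type*} {T : SimpleGraph V}

theorem reachable_of_reachable_sup_edge {x y v : V} (h : (T ⊔ edge x y).Reachable x v) :
    T.Reachable x v ∨ T.Reachable y v := by
  rw [reachable_iff_reflTransGen] at h
  induction h with
  | refl => exact Or.inl (Reachable.refl _)
  | tail _ hvw ih =>
    rcases hvw with hvw | hvw
    · exact ih.imp (fun h => h.trans hvw.reachable) fun h => h.trans hvw.reachable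
    · rw [edge_adj] at hvw
      rcases hvw.1 with ⟨-, rfl⟩ | ⟨-, rfl⟩
      · exact Or.inr (Reachable.refl _)
      · exact Or.inl (Reachable.refl _)

theorem card_edgeSet_sup_edge [Finite V] {x y : V} (h : ¬ T.Reachable x y) :
    Nat.card (T ⊔ edge x y).edgeSet = Nat.card T.edgeSet + 1 := by
  have hne : x ≠ y := fun hxy => h (hxy ▸ Reachable.refl _)
  have hs : (T ⊔ edge x y).edgeSet = insert s(x, y) T.edgeSet := by
    rw [edgeSet_sup, edgeSet_edge_of_ne hne, Set.union_comm, Set.insert_eq]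
  have hmem : s(x, y) ∉ T.edgeSet := fun hxy => h (Adj.reachable hxy)
  rw [hs, Nat.card_coe_set_eq, Nat.card_coe_set_eq,
    Set.ncard_insert_of_notMem hmem (Set.toFinite _)]

/-- Joining the two components by the edge `x y` creates no cycle and makes the graph connected, so
the edge count of trees applies. -/
theorem isAcyclic_iff_of_two_roots [Finite V] {x y : V} (hxy : ¬ T.Reachable x y)
    (h : ∀ v, T.Reachable x v ∨ T.Reachable y v) :
    T.IsAcyclic ↔ Nat.card T.edgeSet + 2 = Nat.card V := by
  have hadj : (T ⊔ edge x y).Reachable x y := by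
    refine Adj.reachable (Or.inr ?_)
    rw [edge_adj]
    exact ⟨Or.inl ⟨rfl, rfl⟩, fun e => hxy (e ▸ Reachable.refl _)⟩
  have hconn : (T ⊔ edge x y).Connected := by
    have hx : ∀ v, (T ⊔ edge x y).Reachable x v := fun v =>
      (h v).elim (fun h => h.mono le_sup_left) fun h => hadj.trans (h.mono le_sup_left)
    exact (connected_iff _).2 ⟨fun u v => (hx u).symm.trans (hx v), ⟨x⟩⟩
  have h1 := isTree_iff_connected_and_card (G := T ⊔ edge x y)
  rw [isTree_iff, and_congr_right_iff] at h1
  rw [← isAcyclic_add_edge_iff_of_not_reachable x y hxy, h1 hconn, card_edgeSet_sup_edge hxy]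

theorem isAcyclic_iff_of_three_roots [Finite V] {x y z : V} (hxy : ¬ T.Reachable x y)
    (hxz : ¬ T.Reachable x z) (hyz : ¬ T.Reachable y z)
    (h : ∀ v, T.Reachable x v ∨ T.Reachable y v ∨ T.Reachable z v) :
    T.IsAcyclic ↔ Nat.card T.edgeSet + 3 = Nat.card V := by
  have hadj : (T ⊔ edge x y).Reachable x y := by
    refine Adj.reachable (Or.inr ?_)
    rw [edge_adj]
    exact ⟨Or.inl ⟨rfl, rfl⟩, fun e => hxy (e ▸ Reachable.refl _)⟩
  rw [← isAcyclic_add_edge_iff_of_not_reachable x y hxy,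
    isAcyclic_iff_of_two_roots (x := x) (y := z), card_edgeSet_sup_edge hxy]
  · exact fun h' => (reachable_of_reachable_sup_edge h').elim hxz hyz
  · intro v
    rcases h v with h | h | h
    · exact Or.inl (h.mono le_sup_left)
    · exact Or.inl (hadj.trans (h.mono le_sup_left))
    · exact Or.inr (h.mono le_sup_left)

theorem card_connectedComponent_eq_two_iff [Finite V] {x y : V} (hxy : ¬ T.Reachable x y) :
    Nat.card T.ConnectedComponent = 2 ↔ ∀ v, T.Reachable x v ∨ T.Reachable y v := by
  have hne : T.connectedComponentMk x ≠ T.connectedComponentMk y := fun h =>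
    hxy (ConnectedComponent.exact h)
  have hc := Set.ncard_pair hne
  rw [← Set.ncard_univ]
  constructor
  · intro h v
    have := Set.eq_of_subset_of_ncard_le (Set.subset_univ
      {T.connectedComponentMk x, T.connectedComponentMk y}) (by rw [h, hc]) (Set.toFinite _)
    have hv : T.connectedComponentMk v ∈
        ({T.connectedComponentMk x, T.connectedComponentMk y} : Set _) := this ▸ Set.mem_univ _
    exact hv.imp (fun h => (ConnectedComponent.exact h).symm)
      fun h => (ConnectedComponent.exact h).symm
  · intro h
    rw [← hc]
    congr 1
    symm
    refine Set.eq_univ_of_forall fun c => ?_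
    induction c using ConnectedComponent.ind with | _ v
    exact (h v).imp (fun h => (ConnectedComponent.sound h).symm)
      fun h => (ConnectedComponent.sound h).symm

theorem card_connectedComponent_eq_three_iff [Finite V] {x y z : V} (hxy : ¬ T.Reachable x y)
    (hxz : ¬ T.Reachable x z) (hyz : ¬ T.Reachable y z) :
    Nat.card T.ConnectedComponent = 3 ↔
      ∀ v, T.Reachable x v ∨ T.Reachable y v ∨ T.Reachable z v := by
  have hc : ({T.connectedComponentMk x, T.connectedComponentMk y,
      T.connectedComponentMk z} : Set _).ncard = 3 :=
    Set.ncard_eq_three.2 ⟨_, _, _, fun h => hxy (ConnectedComponent.exact h),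
      fun h => hxz (ConnectedComponent.exact h), fun h => hyz (ConnectedComponent.exact h), rfl⟩
  rw [← Set.ncard_univ]
  constructor
  · intro h v
    have := Set.eq_of_subset_of_ncard_le (Set.subset_univ
      {T.connectedComponentMk x, T.connectedComponentMk y, T.connectedComponentMk z})
      (by rw [h, hc]) (Set.toFinite _)
    have hv : T.connectedComponentMk v ∈ ({T.connectedComponentMk x, T.connectedComponentMk y,
        T.connectedComponentMk z} : Set _) := this ▸ Set.mem_univ _
    exact hv.imp (fun h => (ConnectedComponent.exact h).symm)
      (Or.imp (fun h => (ConnectedComponent.exact h).symm)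
        fun h => (ConnectedComponent.exact h).symm)
  · intro h
    rw [← hc]
    congr 1
    symm
    refine Set.eq_univ_of_forall fun c => ?_
    induction c using ConnectedComponent.ind with | _ v
    exact (h v).imp (fun h => (ConnectedComponent.sound h).symm)
      (Or.imp (fun h => (ConnectedComponent.sound h).symm)
        fun h => (ConnectedComponent.sound h).symm)

end Forest

/-! ### Spanning subgraphs as edge sets -/

/-- The spanning subgraph of `SG(n)` with edge set `E`. -/
def graphOf (n : ℕ) (E : Finset (Sym2 (ℕ × ℕ))) : SimpleGraph (Vert n) :=
  SimpleGraph.comap Subtype.val (SimpleGraph.fromEdgeSet (E : Set (Sym2 (ℕ × ℕ))))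

section GraphOf

variable {n : ℕ} {E : Finset (Sym2 (ℕ × ℕ))}

theorem graphOf_adj (hE : E ⊆ edges n) {u v : Vert n} :
    (graphOf n E).Adj u v ↔ s(u.1, v.1) ∈ E := by
  simp only [graphOf, SimpleGraph.comap_adj, SimpleGraph.fromEdgeSet_adj, Finset.mem_coe]
  exact ⟨And.left, fun h => ⟨h, (mem_verts_of_mem_edges (hE h)).2.2⟩⟩

theorem graphOf_le (hE : E ⊆ edges n) : graphOf n E ≤ SG n := by
  intro u v h
  exact (graphOf_adj (n := n) subset_rfl).2 (hE ((graphOf_adj hE).1 h))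

theorem graphOf_reachable (hE : E ⊆ edges n) {u v : Vert n} :
    (graphOf n E).Reachable u v ↔ Conn E u.1 v.1 := by
  constructor
  · intro h
    rw [SimpleGraph.reachable_iff_reflTransGen] at h
    induction h with
    | refl => exact Relation.ReflTransGen.refl
    | tail _ h ih => exact Relation.ReflTransGen.tail ih ((graphOf_adj hE).1 h)
  · intro h
    have key : ∀ w, Conn E u.1 w → ∃ hw : w ∈ verts n, (graphOf n E).Reachable u ⟨w, hw⟩ := by
      intro w hw
      induction hw with
      | refl => exact ⟨u.2, SimpleGraph.Reachable.refl _⟩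
      | tail _ h ih =>
        obtain ⟨hx, hr⟩ := ih
        refine ⟨(mem_verts_of_mem_edges (hE h)).2.1, hr.trans (SimpleGraph.Adj.reachable ?_)⟩
        exact (graphOf_adj hE).2 h
    exact (key _ h).2

theorem map_edgeSet_graphOf (hE : E ⊆ edges n) :
    Sym2.map Subtype.val '' (graphOf n E).edgeSet = (E : Set (Sym2 (ℕ × ℕ))) := by
  ext e
  constructor
  · rintro ⟨e', he', rfl⟩
    induction e' with | _ u v
    exact (graphOf_adj hE).1 he'
  · intro he
    induction e with | _ p q
    obtain ⟨hp, hq, -⟩ := mem_verts_of_mem_edges (hE he)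
    exact ⟨s(⟨p, hp⟩, ⟨q, hq⟩), (graphOf_adj hE).2 he, rfl⟩

theorem card_edgeSet_graphOf (hE : E ⊆ edges n) : Nat.card (graphOf n E).edgeSet = E.card := by
  rw [← Set.ncard_coe_finset, ← map_edgeSet_graphOf hE, Nat.card_coe_set_eq,
    Set.ncard_image_of_injective _ (Sym2.map.injective Subtype.val_injective)]

theorem ncard_neighborSet_graphOf (hE : E ⊆ edges n) (x : Vert n) :
    ((graphOf n E).neighborSet x).ncard = degreeAt E x.1 := by
  have hinj : Function.Injective fun y : Vert n => s(x.1, y.1) := fun y z h =>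
    Subtype.ext (Sym2.congr_right.1 h)
  rw [← Set.ncard_image_of_injective _ hinj, degreeAt, ← Set.ncard_coe_finset]
  congr 1
  ext e
  simp only [Set.mem_image, SimpleGraph.mem_neighborSet, Finset.coe_filter, Set.mem_ofPred_eq]
  constructor
  · rintro ⟨y, hy, rfl⟩
    exact ⟨(graphOf_adj hE).1 hy, Sym2.mem_mk_left _ _⟩
  · rintro ⟨he, q, rfl⟩
    exact ⟨⟨q, (mem_verts_of_mem_edges (hE he)).2.1⟩, (graphOf_adj hE).2 he, rfl⟩

theorem exists_graphOf_eq {T : SimpleGraph (Vert n)} (hT : T ≤ SG n) :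
    ∃ E ⊆ edges n, graphOf n E = T := by
  classical
  have hsub : (edges n).filter (fun e => e ∈ Sym2.map Subtype.val '' T.edgeSet) ⊆ edges n :=
    Finset.filter_subset _ _
  refine ⟨_, hsub, ?_⟩
  ext u v
  rw [graphOf_adj hsub, Finset.mem_filter]
  constructor
  · rintro ⟨-, e, he, h⟩
    rw [← Sym2.map_mk (f := Subtype.val)] at h
    rw [Sym2.map.injective Subtype.val_injective h] at he
    exact he
  · exact fun h => ⟨(graphOf_adj (n := n) subset_rfl).1 (hT h), s(u, v), h, rfl⟩

theorem graphOf_injOn : Set.InjOn (graphOf n) {E | E ⊆ edges n} := by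
  intro E hE F hF h
  have := map_edgeSet_graphOf hE
  rw [h, map_edgeSet_graphOf hF] at this
  exact (Finset.coe_injective this).symm

theorem spans_iff_reachable (hE : E ⊆ edges n) : Spans n E ↔ ∀ v,
    (graphOf n E).Reachable (o n) v ∨ (graphOf n E).Reachable (a n) v ∨
      (graphOf n E).Reachable (b n) v := by
  simp only [graphOf_reachable hE, Spans, Subtype.forall, Fin.exists_fin_succ]
  simp [corner, o, a, b]

/-- Pattern 3 separates `b` from `o` and `a`. With `o` and `b` as roots, having two components
amounts to `Spans`, and acyclicity to the edge count with rank 2. -/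
theorem graphOf_mem_twoTrees (hE : E ⊆ edges n) :
    graphOf n E ∈ twoTrees n ↔ E ∈ configs n 3 := by
  have hp : HasPattern n E 3 ↔
      (graphOf n E).Reachable (o n) (a n) ∧ ¬ (graphOf n E).Reachable (o n) (b n) := by
    obtain ⟨π, hπ⟩ := exists_hasPattern n E
    have h1 : (graphOf n E).Reachable (o n) (a n) ↔ lab π 0 = lab π 1 :=
      (graphOf_reachable hE).trans (hπ 0 1)
    have h2 : (graphOf n E).Reachable (o n) (b n) ↔ lab π 0 = lab π 2 :=
      (graphOf_reachable hE).trans (hπ 0 2)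
    rw [h1, h2]
    constructor
    · intro h
      rw [hπ.unique h]
      decide
    · have : ∀ π : Fin 5, lab π 0 = lab π 1 ∧ ¬ lab π 0 = lab π 2 → π = 3 := by decide
      exact fun h => this π h ▸ hπ
  have hr : rank 3 = 2 := by decide
  rw [mem_configs, hp, spans_iff_reachable hE, hr]
  simp only [twoTrees, spanningForests, Set.mem_ofPred_eq]
  have hcard : Nat.card (Vert n) = (verts n).card := Nat.card_eq_card_toFinset _ |>.trans (by simp)
  constructor
  · rintro ⟨⟨-, hac, hcc⟩, hoa, hob⟩
    have h2 := (card_connectedComponent_eq_two_iff hob).1 hcc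
    rw [isAcyclic_iff_of_two_roots hob h2, card_edgeSet_graphOf hE, hcard] at hac
    exact ⟨hE, ⟨fun v => (h2 v).imp_right Or.inr, hoa, hob⟩, hac⟩
  · rintro ⟨-, ⟨hs, hoa, hob⟩, hc⟩
    have h2 : ∀ v, (graphOf n E).Reachable (o n) v ∨ (graphOf n E).Reachable (b n) v := by
      intro v
      rcases hs v with h | h | h
      exacts [Or.inl h, Or.inl (hoa.trans h), Or.inr h]
    refine ⟨⟨graphOf_le hE, ?_, (card_connectedComponent_eq_two_iff hob).2 h2⟩, hoa, hob⟩
    rw [isAcyclic_iff_of_two_roots hob h2, card_edgeSet_graphOf hE, hcard, hc]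

theorem graphOf_mem_threeTrees (hE : E ⊆ edges n) :
    graphOf n E ∈ threeTrees n ↔ E ∈ configs n 4 := by
  have hp : HasPattern n E 4 ↔ ¬ (graphOf n E).Reachable (o n) (a n) ∧
      ¬ (graphOf n E).Reachable (o n) (b n) ∧ ¬ (graphOf n E).Reachable (a n) (b n) := by
    obtain ⟨π, hπ⟩ := exists_hasPattern n E
    have h1 : (graphOf n E).Reachable (o n) (a n) ↔ lab π 0 = lab π 1 :=
      (graphOf_reachable hE).trans (hπ 0 1)
    have h2 : (graphOf n E).Reachable (o n) (b n) ↔ lab π 0 = lab π 2 :=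
      (graphOf_reachable hE).trans (hπ 0 2)
    have h3 : (graphOf n E).Reachable (a n) (b n) ↔ lab π 1 = lab π 2 :=
      (graphOf_reachable hE).trans (hπ 1 2)
    rw [h1, h2, h3]
    constructor
    · intro h
      rw [hπ.unique h]
      decide
    · have : ∀ π : Fin 5, ¬ lab π 0 = lab π 1 ∧ ¬ lab π 0 = lab π 2 ∧ ¬ lab π 1 = lab π 2 →
          π = 4 := by decide
      exact fun h => this π h ▸ hπ
  have hr : rank 4 = 3 := by decide
  rw [mem_configs, hp, spans_iff_reachable hE, hr]
  simp only [threeTrees, spanningForests, Set.mem_ofPred_eq]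
  have hcard : Nat.card (Vert n) = (verts n).card := Nat.card_eq_card_toFinset _ |>.trans (by simp)
  constructor
  · rintro ⟨⟨-, hac, hcc⟩, hoa, hob, hab⟩
    have h2 := (card_connectedComponent_eq_three_iff hoa hob hab).1 hcc
    rw [isAcyclic_iff_of_three_roots hoa hob hab h2, card_edgeSet_graphOf hE, hcard] at hac
    exact ⟨hE, ⟨h2, hoa, hob, hab⟩, hac⟩
  · rintro ⟨-, ⟨hs, hoa, hob, hab⟩, hc⟩
    refine ⟨⟨graphOf_le hE, ?_, (card_connectedComponent_eq_three_iff hoa hob hab).2 hs⟩,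
      hoa, hob, hab⟩
    rw [isAcyclic_iff_of_three_roots hoa hob hab hs, card_edgeSet_graphOf hE, hcard, hc]

end GraphOf

/-! ### From edge sets back to the ratios `G` and `H` -/

open Classical in
theorem ncard_eq_card_filter {n : ℕ} {S : Set (SimpleGraph (Vert n))} {π : Fin 5}
    (hle : ∀ T ∈ S, T ≤ SG n) (hS : ∀ E ⊆ edges n, graphOf n E ∈ S ↔ E ∈ configs n π)
    (P : SimpleGraph (Vert n) → Prop) :
    {T | T ∈ S ∧ P T}.ncard = ((configs n π).filter fun E => P (graphOf n E)).card := by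
  have himg : {T | T ∈ S ∧ P T} = graphOf n ''
      (((configs n π).filter fun E => P (graphOf n E) : Finset _) : Set _) := by
    ext T
    simp only [Set.mem_ofPred_eq, Finset.coe_filter, Set.mem_image]
    constructor
    · rintro ⟨hT, hP⟩
      obtain ⟨E, hE, rfl⟩ := exists_graphOf_eq (hle T hT)
      exact ⟨E, ⟨(hS E hE).1 hT, hP⟩, rfl⟩
    · rintro ⟨E, ⟨hE, hP⟩, rfl⟩
      exact ⟨(hS E (mem_configs.1 hE).1).2 hE, hP⟩
  rw [himg, Set.InjOn.ncard_image, Set.ncard_coe_finset]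
  exact graphOf_injOn.mono fun E hE => (mem_configs.1 (Finset.mem_filter.1 hE).1).1

theorem cast_ncard_eq_total {n : ℕ} {S : Set (SimpleGraph (Vert n))} {π : Fin 5}
    (hle : ∀ T ∈ S, T ≤ SG n) (hS : ∀ E ⊆ edges n, graphOf n E ∈ S ↔ E ∈ configs n π) :
    (S.ncard : ℝ) = total n π := by
  have := ncard_eq_card_filter hle hS fun _ => True
  simp only [and_true, Set.ofPred_mem_eq, Finset.filter_true] at this
  simp [this, total, weight]

theorem cast_ncard_eq_degreeCount {n : ℕ} {S : Set (SimpleGraph (Vert n))} {π : Fin 5}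
    (hle : ∀ T ∈ S, T ≤ SG n) (hS : ∀ E ⊆ edges n, graphOf n E ∈ S ↔ E ∈ configs n π)
    {x : Vert n} {c : Fin 3} (hx : x.1 = corner n c) (d : ℕ) :
    ({T | T ∈ S ∧ (T.neighborSet x).ncard = d}.ncard : ℝ) = degreeCount n c d π := by
  classical
  rw [ncard_eq_card_filter hle hS, degreeCount, weight, Finset.sum_boole]
  refine congrArg (fun s : Finset _ => (s.card : ℝ)) (Finset.ext fun E => ?_)
  simp only [Finset.mem_filter]
  refine and_congr_right fun hE => ?_
  rw [ncard_neighborSet_graphOf (mem_configs.1 hE).1, hx]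

theorem G_top (n : ℕ) (d : Fin 3) : G d n (b n) = degreeDist d n 1 := by
  have hle : ∀ T ∈ twoTrees n, T ≤ SG n := fun T hT => hT.1.1
  rw [G, gDeg, g, cast_ncard_eq_total hle fun E => graphOf_mem_twoTrees,
    cast_ncard_eq_degreeCount (c := 2) hle (fun E => graphOf_mem_twoTrees) rfl,
    degreeCount_top_eq, mul_div_cancel_right₀ _ (total_pos n 3).ne']
  rfl

theorem H_left (n : ℕ) (d : Fin 3) : H d n (o n) = degreeDist d n 3 := by
  have hle : ∀ T ∈ threeTrees n, T ≤ SG n := fun T hT => hT.1.1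
  rw [H, hDeg, h, cast_ncard_eq_total hle fun E => graphOf_mem_threeTrees,
    cast_ncard_eq_degreeCount (c := 0) hle (fun E => graphOf_mem_threeTrees) rfl,
    degreeCount_left_eq, mul_div_cancel_right₀ _ (total_pos n 4).ne']
  rfl

end SierpinskiGasket

theorem mainTheorem9 (n : ℕ) :
    SierpinskiGasket.G 0 n (SierpinskiGasket.b n)
        = 33 / 28 * (3 / 5 : ℝ) ^ n - 5 / 28 * (1 / 25 : ℝ) ^ n ∧
    SierpinskiGasket.H 0 n (SierpinskiGasket.o n)
        = 11 / 14 * (3 / 5 : ℝ) ^ n + 3 / 14 * (1 / 25 : ℝ) ^ n ∧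
    SierpinskiGasket.G 1 n (SierpinskiGasket.b n)
        = 11 / 14 - 2 / 7 * (1 / 15 : ℝ) ^ n - 6 / 7 * (3 / 5 : ℝ) ^ n
          + 5 / 14 * (1 / 25 : ℝ) ^ n ∧
    SierpinskiGasket.G 2 n (SierpinskiGasket.b n)
        = 3 / 14 + 2 / 7 * (1 / 15 : ℝ) ^ n - 9 / 28 * (3 / 5 : ℝ) ^ n
          - 5 / 28 * (1 / 25 : ℝ) ^ n ∧
    SierpinskiGasket.H 1 n (SierpinskiGasket.o n)
        = 11 / 14 + 3 / 14 * (1 / 15 : ℝ) ^ n - 4 / 7 * (3 / 5 : ℝ) ^ n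
          - 3 / 7 * (1 / 25 : ℝ) ^ n ∧
    SierpinskiGasket.H 2 n (SierpinskiGasket.o n)
        = 3 / 14 - 3 / 14 * (1 / 15 : ℝ) ^ n - 3 / 14 * (3 / 5 : ℝ) ^ n
          + 3 / 14 * (1 / 25 : ℝ) ^ n :=
  ⟨SierpinskiGasket.G_top n 0, SierpinskiGasket.H_left n 0, SierpinskiGasket.G_top n 1,
    SierpinskiGasket.G_top n 2, SierpinskiGasket.H_left n 1, SierpinskiGasket.H_left n 2⟩
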